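/- Let $d\ge 1$, let $(\Omega,\mathbb P)$ be a probability space, $H$ a complex Hilbert space, and $A=(A_1,\dots,A_d)$ a $d$-tuple of random operators $A_i:\Omega\to\mathcal L(H)$ that are strongly measurable, in the sense that $\omega\mapsto A_i(\omega)u$ and $\omega\mapsto A_i(\omega)^*u$ are strongly measurable for every $u\in H$. Let $\mathbb F_d^+$ be the free semigroup of words on $\{1,\dots,d\}$ with the empty word $\emptyset$ as neutral element. For a $d$-tuple $T$ of operators and a word $\alpha=i_1\cdots i_k$ put $T^\alpha=T_{i_1}\cdots T_{i_k}$ and $T^\emptyset=I$. Assume $\mathbb E\|A^\alpha\|^2<\infty$ for all $\alpha\in\mathbb F_d^+$. Define $$K(\alpha,\beta)=\mathbb E\left[A^\alpha (A^\beta)^*\right]\in\mathcal L(H),\qquad K_\Sigma(\alpha,\beta)=\sum_{i=1}^d K(\alpha i,\beta i),\qquad \alpha,\beta\in\mathbb F_d^+,$$ where the expectation is taken in the strong sense: $K(\alpha,\beta)v=\mathbb E\left[A^\alpha(A^\beta)^*v\right]$ for $v\in H$. A kernel $L:\mathbb F_d^+\times\mathbb F_d^+\to\mathcal L(H)$ is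 called positive definite if $\sum_{i,j=1}^N\langle u_i,L(\alpha_i,\alpha_j)u_j\rangle\ge 0$ for all finite families $(\alpha_j,u_j)_{j=1}^N$ in $\mathbb F_d^+\times H$, and $K_\Sigma\le K$ means that $K-K_\Sigma$ is positive definite. A Cuntz family on a Hilbert space $\mathcal K$ is a $d$-tuple $S=(S_1,\dots,S_d)$ in $\mathcal L(\mathcal K)$ with $S_i^*S_j=\delta_{ij}I$ and $\sum_{i=1}^d S_iS_i^*=I$. The following are equivalent: 1. There exist a Hilbert space $\mathcal K$, a Cuntz family $S$ on $\mathcal K$, an orthogonal projection $P\in\mathcal L(\mathcal K)$ and an isometry $W:H\to\mathcal K$ such that $$K(\alpha,\beta)=W^*S^\alpha P(S^\beta)^*W\quad\text{for all }\alpha,\beta\in\mathbb F_d^+,$$ and $\sum_{i=1}^d S_iPS_i^*\le P$ on $M=\overline{\mathrm{span}}\{(S^\gamma)^*WH:\gamma\in\mathbb F_d^+\}$, that is, $\left\langle y,\sum_{i=1}^d S_iPS_i^*y\right\rangle\le\langle y,Py\rangle$ for all $y\in M$. 2. $K_\Sigma\le K$. Moreover, $K_\Sigma=K$ if and only if there exist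 a Hilbert space $\mathcal K$, a Cuntz family $S$ on $\mathcal K$ and an isometry $W:H\to\mathcal K$ with $$K(\alpha,\beta)=W^*S^\alpha(S^\beta)^*W\quad\text{for all }\alpha,\beta\in\mathbb F_d^+.\qquad(*)$$ In addition, for every realization $(\mathcal K,S,P,W)$ as in 1, $K_\Sigma=K$ if and only if $(*)$ holds for that $S$ and $W$. -/

import Mathlib

universe u v

namespace FreeMoment

open MeasureTheory ContinuousLinearMap
open scoped ComplexOrder

/-- The word power `S^α = S_{i₁} ⋯ S_{iₖ}` for `α = i₁ ⋯ iₖ` in the free monoid on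
`{1, …, d}`, with `S^∅ = I`. The product in `E →L[ℂ] E` is composition. -/
noncomputable def wordPow {d : ℕ} {E : Type*} [NormedAddCommGroup E] [InnerProductSpace ℂ E]
    (S : Fin d → E →L[ℂ] E) (α : FreeMonoid (Fin d)) : E →L[ℂ] E :=
  FreeMonoid.lift S α

/-- A `d`-tuple of random operators on `H` with finite second moments `𝔼 ‖A^α‖² < ∞` for all
words `α`. Measurability is in the sense of the strong operator topology, for the operators and
for their adjoints: `ω ↦ A_i(ω) u` and `ω ↦ A_i(ω)^* u` are strongly measurable for all `u`.
If `H` is separable, the second condition follows from the first, and both hold when `A_i` is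
strongly measurable for the operator norm. -/
structure IsRandomTuple {d : ℕ} {Ω H : Type*} [MeasurableSpace Ω] [NormedAddCommGroup H]
    [InnerProductSpace ℂ H] [CompleteSpace H] (ℙ : Measure Ω)
    (A : Fin d → Ω → H →L[ℂ] H) : Prop where
  aesm : ∀ i u, AEStronglyMeasurable (fun ω => A i ω u) ℙ
  aesm_adjoint : ∀ i u, AEStronglyMeasurable (fun ω => adjoint (A i ω) u) ℙ
  integrable_sq : ∀ α : FreeMonoid (Fin d),
    Integrable (fun ω => ‖wordPow (fun i => A i ω) α‖ ^ 2) ℙ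

section Kernel

variable {d : ℕ} {Ω H : Type*} [MeasurableSpace Ω] [NormedAddCommGroup H]
  [InnerProductSpace ℂ H] [CompleteSpace H] {ℙ : Measure Ω} {A : Fin d → Ω → H →L[ℂ] H}

theorem aesm_apply {H : Type*} [NormedAddCommGroup H] [InnerProductSpace ℂ H]
    {T : Ω → H →L[ℂ] H} (hT : ∀ u, AEStronglyMeasurable (fun ω => T ω u) ℙ)
    {f : Ω → H} (hf : AEStronglyMeasurable f ℙ) :
    AEStronglyMeasurable (fun ω => T ω (f ω)) ℙ := by
  obtain ⟨g, hg, hfg⟩ := hf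
  have key : AEStronglyMeasurable (fun ω => T ω (g ω)) ℙ := by
    refine aestronglyMeasurable_of_tendsto_ae Filter.atTop
      (f := fun n ω => T ω (hg.approx n ω)) (fun n => ?_) (Filter.Eventually.of_forall fun ω =>
        ((T ω).continuous.tendsto _).comp (hg.tendsto_approx ω))
    induction hg.approx n using SimpleFunc.induction with
    | @const c s hs =>
      have : (fun ω => T ω ((SimpleFunc.piecewise s hs (SimpleFunc.const Ω c)
          (SimpleFunc.const Ω 0)) ω)) = s.indicator (fun ω => T ω c) := by
        funext ω
        by_cases h : ω ∈ s <;> simp [h]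
      rw [this]
      exact (hT c).indicator hs
    | @add p q _ hp hq => exact (hp.add hq).congr (Filter.Eventually.of_forall fun ω => by simp)
  refine key.congr ?_
  filter_upwards [hfg] with ω h
  rw [h]

theorem wordPow_one {E : Type*} [NormedAddCommGroup E] [InnerProductSpace ℂ E]
    (S : Fin d → E →L[ℂ] E) : wordPow S 1 = 1 := by
  simp [wordPow]

theorem wordPow_of_mul {E : Type*} [NormedAddCommGroup E] [InnerProductSpace ℂ E]
    (S : Fin d → E →L[ℂ] E) (i : Fin d) (α : FreeMonoid (Fin d)) :
    wordPow S (FreeMonoid.of i * α) = S i * wordPow S α := by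
  simp [wordPow]

theorem IsRandomTuple.aesm_wordPow (hA : IsRandomTuple ℙ A) (α : FreeMonoid (Fin d)) :
    ∀ u, AEStronglyMeasurable (fun ω => wordPow (fun i => A i ω) α u) ℙ := by
  induction α using FreeMonoid.inductionOn' with
  | one => intro u; simpa [wordPow_one] using aestronglyMeasurable_const
  | of_mul i α ih =>
    intro u
    simp only [wordPow_of_mul]
    exact aesm_apply (hA.aesm i) (ih u)

theorem IsRandomTuple.aesm_adjoint_wordPow (hA : IsRandomTuple ℙ A) (α : FreeMonoid (Fin d)) :
    ∀ u, AEStronglyMeasurable (fun ω => adjoint (wordPow (fun i => A i ω) α) u) ℙ := by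
  induction α using FreeMonoid.inductionOn' with
  | one =>
    intro u
    simp only [wordPow_one, ← star_eq_adjoint, star_one]
    exact aestronglyMeasurable_const
  | of_mul i α ih =>
    intro u
    simp only [wordPow_of_mul, ← star_eq_adjoint, star_mul]
    exact aesm_apply ih (hA.aesm_adjoint i u)

theorem IsRandomTuple.integrable_norm_mul_norm (hA : IsRandomTuple ℙ A)
    (α β : FreeMonoid (Fin d)) :
    Integrable (fun ω => ‖wordPow (fun i => A i ω) α‖ * ‖wordPow (fun i => A i ω) β‖) ℙ := by
  have hm : ∀ γ, AEStronglyMeasurable (fun ω => ‖wordPow (fun i => A i ω) γ‖) ℙ := fun γ => by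
    have := (hA.integrable_sq γ).aestronglyMeasurable.aemeasurable.sqrt.aestronglyMeasurable
    simpa [Real.sqrt_sq] using this
  refine ((hA.integrable_sq α).add (hA.integrable_sq β)).mono' ((hm α).mul (hm β))
    (Filter.Eventually.of_forall fun ω => ?_)
  rw [Real.norm_of_nonneg (by positivity), Pi.add_apply]
  nlinarith [sq_nonneg (‖wordPow (fun i => A i ω) α‖ - ‖wordPow (fun i => A i ω) β‖),
    sq_nonneg ‖wordPow (fun i => A i ω) α‖, sq_nonneg ‖wordPow (fun i => A i ω) β‖]

theorem norm_moment_le {Ω : Type*} {A : Fin d → Ω → H →L[ℂ] H} (α β : FreeMonoid (Fin d)) (v : H) (ω : Ω) :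
    ‖wordPow (fun i => A i ω) α (adjoint (wordPow (fun i => A i ω) β) v)‖ ≤
      ‖wordPow (fun i => A i ω) α‖ * ‖wordPow (fun i => A i ω) β‖ * ‖v‖ := by
  refine (le_opNorm _ _).trans ?_
  rw [mul_assoc]
  gcongr
  refine (le_opNorm _ _).trans ?_
  rw [LinearIsometryEquiv.norm_map]

theorem IsRandomTuple.integrable_moment (hA : IsRandomTuple ℙ A) (α β : FreeMonoid (Fin d))
    (v : H) :
    Integrable (fun ω =>
      wordPow (fun i => A i ω) α (adjoint (wordPow (fun i => A i ω) β) v)) ℙ :=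
  ((hA.integrable_norm_mul_norm α β).mul_const ‖v‖).mono'
    (aesm_apply (hA.aesm_wordPow α) (hA.aesm_adjoint_wordPow β v))
    (Filter.Eventually.of_forall fun ω => norm_moment_le α β v ω)

/-- The moment kernel `K(α, β) = 𝔼[A^α (A^β)^*]`, as the bounded operator
`v ↦ ∫ A^α (A^β)^* v dℙ` (Bochner integral in `H`; the integrand is integrable). -/
noncomputable def momentKernel (hA : IsRandomTuple ℙ A) (α β : FreeMonoid (Fin d)) :
    H →L[ℂ] H :=
  LinearMap.mkContinuous
    { toFun := fun v => ∫ ω,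
        wordPow (fun i => A i ω) α (adjoint (wordPow (fun i => A i ω) β) v) ∂ℙ
      map_add' := fun v w => by
        simp only [map_add]
        exact integral_add (hA.integrable_moment α β v) (hA.integrable_moment α β w)
      map_smul' := fun c v => by
        simp only [map_smul, RingHom.id_apply]
        exact integral_smul c _ }
    (∫ ω, ‖wordPow (fun i => A i ω) α‖ * ‖wordPow (fun i => A i ω) β‖ ∂ℙ)
    (fun v => by
      rw [← integral_mul_const]
      exact norm_integral_le_of_norm_le ((hA.integrable_norm_mul_norm α β).mul_const ‖v‖)
        (Filter.Eventually.of_forall fun ω => norm_moment_le α β v ω))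

theorem momentKernel_apply (hA : IsRandomTuple ℙ A) (α β : FreeMonoid (Fin d)) (v : H) :
    momentKernel hA α β v = ∫ ω,
      wordPow (fun i => A i ω) α (adjoint (wordPow (fun i => A i ω) β) v) ∂ℙ := rfl

end Kernel

section Dilation

variable {d : ℕ} {H 𝒦 : Type*} [NormedAddCommGroup H] [InnerProductSpace ℂ H]
  [NormedAddCommGroup 𝒦] [InnerProductSpace ℂ 𝒦]

/-- An operator-valued kernel on a set `X` is positive definite if
`∑_{i,j} ⟨u_i, K(x_i, x_j) u_j⟩ ≥ 0` for all finite families `(x_j, u_j)`. -/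
def IsPosDefKernel {X : Type*} (K : X → X → H →L[ℂ] H) : Prop :=
  ∀ (N : ℕ) (x : Fin N → X) (u : Fin N → H),
    0 ≤ ∑ i, ∑ j, inner ℂ (u i) (K (x i) (x j) (u j))

/-- The order `K ≤ L` on kernels: `L - K` is positive definite. -/
def KernelLE {X : Type*} (K L : X → X → H →L[ℂ] H) : Prop :=
  IsPosDefKernel (fun x y => L x y - K x y)

/-- The shifted kernel `K_Σ(α, β) = ∑_i K(αi, βi)`. -/
noncomputable def shiftKernel (K : FreeMonoid (Fin d) → FreeMonoid (Fin d) → H →L[ℂ] H) :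
    FreeMonoid (Fin d) → FreeMonoid (Fin d) → H →L[ℂ] H :=
  fun α β => ∑ i, K (α * FreeMonoid.of i) (β * FreeMonoid.of i)

variable [CompleteSpace H] [CompleteSpace 𝒦]

/-- A Cuntz family: `S_i^* S_j = δ_{ij} I` and `∑_i S_i S_i^* = I`. -/
structure IsCuntzFamily (S : Fin d → 𝒦 →L[ℂ] 𝒦) : Prop where
  adjoint_mul : ∀ i j, adjoint (S i) * S j = if i = j then 1 else 0
  sum_mul_adjoint : ∑ i, S i * adjoint (S i) = 1

/-- The closed linear span `M` of the vectors `(S^γ)^* W h`, for words `γ` and `h ∈ H`. -/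
noncomputable def cyclicSubspace (S : Fin d → 𝒦 →L[ℂ] 𝒦) (W : H →ₗᵢ[ℂ] 𝒦) : Submodule ℂ 𝒦 :=
  (Submodule.span ℂ {y : 𝒦 | ∃ (γ : FreeMonoid (Fin d)) (h : H),
    y = adjoint (wordPow S γ) (W h)}).topologicalClosure

/-- `T ≤ R` on the subspace `M`: `⟨y, T y⟩ ≤ ⟨y, R y⟩` for all `y ∈ M`. -/
def LEOn (T R : 𝒦 →L[ℂ] 𝒦) (M : Submodule ℂ 𝒦) : Prop :=
  ∀ y ∈ M, inner ℂ y (T y) ≤ inner ℂ y (R y)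

/-- The data `(S, P, W)` is a Cuntz dilation of the kernel `K`: `S` is a Cuntz family, `P` is an
orthogonal projection, `K(α, β) = W^* S^α P (S^β)^* W` for all words `α, β`, and
`∑_i S_i P S_i^* ≤ P` on the cyclic subspace `M`. -/
structure IsCuntzDilation (K : FreeMonoid (Fin d) → FreeMonoid (Fin d) → H →L[ℂ] H)
    (S : Fin d → 𝒦 →L[ℂ] 𝒦) (P : 𝒦 →L[ℂ] 𝒦) (W : H →ₗᵢ[ℂ] 𝒦) : Prop where
  cuntz : IsCuntzFamily S
  projection : IsStarProjection P
  kernel_eq : ∀ α β, K α β =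
    adjoint W.toContinuousLinearMap ∘L wordPow S α ∘L P ∘L adjoint (wordPow S β) ∘L
      W.toContinuousLinearMap
  le_on : LEOn (∑ i, S i * P * adjoint (S i)) P (cyclicSubspace S W)

/-- The realization without a projection: `K(α, β) = W^* S^α (S^β)^* W` for all `α, β`. -/
def IsFreeRealization (K : FreeMonoid (Fin d) → FreeMonoid (Fin d) → H →L[ℂ] H)
    (S : Fin d → 𝒦 →L[ℂ] 𝒦) (W : H →ₗᵢ[ℂ] 𝒦) : Prop :=
  ∀ α β, K α β =
    adjoint W.toContinuousLinearMap ∘L wordPow S α ∘L adjoint (wordPow S β) ∘L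
      W.toContinuousLinearMap

end Dilation

end FreeMoment

/-!
Only the implication from `K_Σ ≤ K` to the existence of a dilation needs a construction. The moment
kernel is positive definite, because its quadratic form is `𝔼 ‖∑_j (A^{α_j})^* u_j‖²`, so it has a
Kolmogorov decomposition `K(α, β) = V_α^* V_β`, where `V_∅` is an isometry since `K(∅, ∅) = 1`. The
inequality `K_Σ ≤ K` says exactly that the right shifts `C_i : V_α u ↦ V_{αi} u` are well defined
and satisfy `∑ C_i^* C_i ≤ 1` (`KernelLE.exists_column`). Hence `T_i = C_i^*` is a row contraction
with `(T^α)^* V_∅ = V_α`, and it has a Cuntz dilation `J^* S^α J = T^α`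
(`exists_cuntz_dilation`). With `P = J J^*` and `W = J V_∅` one gets
`W^* S^α P (S^β)^* W = V_∅^* T^α (T^β)^* V_∅ = K(α, β)`.

The Cuntz dilation is built on the side of the columns. Adding a defect operator followed by a
shift on a full Fock space turns the column contraction `C` into an isometric column; the orthogonal
complement of the range of an isometric column is then absorbed by a second Fock space `F`, for
which `F ≅ Rᗮ ⊕ F^d`, and this gives a unitary column, that is, a Cuntz family.

The order condition on the cyclic subspace is equivalent to `K_Σ ≤ K` for every realization, since
at `y = ∑_j (S^{α_j})^* W u_j` the forms of `P` and of `∑ S_i P S_i^*` are the forms of `K` and of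
`K_Σ` (`leOn_iff_kernelLE`). Finally, if `K_Σ = K` then these two forms agree, and comparing norms
letter by letter shows that `P` fixes every `(S^α)^* W u`, so that `P` can be dropped
(`IsCuntzDilation.isFreeRealization`); the converse is `∑ S_i S_i^* = 1`.
-/

namespace FreeMoment
open MeasureTheory ContinuousLinearMap
open scoped ComplexOrder InnerProductSpace

/-! ### Cuntz families from unitary columns -/

section Column

variable {d : ℕ} {E : Type*} [NormedAddCommGroup E] [InnerProductSpace ℂ E] [CompleteSpace E]

/-- If the column `x ↦ (B₁ x, …, B_d x)` is a unitary operator `E → E^d`, then the adjoints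
`B_i^*` form a Cuntz family. -/
theorem IsCuntzFamily.of_column {B : Fin d → E →L[ℂ] E}
    (hB : ∀ x y, inner ℂ x y = ∑ i, inner ℂ (B i x) (B i y))
    (hsurj : ∀ f : Fin d → E, ∃ x, ∀ i, B i x = f i) :
    IsCuntzFamily (fun i => adjoint (B i)) where
  adjoint_mul i j := by
    ext x
    obtain ⟨z, hz⟩ := hsurj (Pi.single j x)
    have : adjoint (B j) x = z := by
      refine ext_inner_right ℂ fun y => ?_
      rw [adjoint_inner_left, hB z y, Finset.sum_eq_single j]
      · simp [hz]
      · intro k _ hk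
        simp [hz, hk]
      · simp
    rw [adjoint_adjoint, mul_apply_eq_comp, this, hz]
    by_cases h : i = j
    · subst h; simp
    · simp [h]
  sum_mul_adjoint := by
    ext x
    refine ext_inner_left ℂ fun y => ?_
    simp [sum_apply, inner_sum, adjoint_inner_right, hB y x]

end Column

/-! ### The full Fock space -/

section Fock

/-- A sum over words, split according to the first letter. -/
theorem hasSum_list {d : ℕ} {α : Type*} [AddCommMonoid α] [TopologicalSpace α]
    [ContinuousAdd α] {F : List (Fin d) → α} {a : Fin d → α}
    (h : ∀ i, HasSum (fun w => F (i :: w)) (a i)) :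
    HasSum F (F [] + ∑ i, a i) := by
  have h1 : ∀ i : Fin d, HasSum (Function.extend (List.cons i) (fun w => F (i :: w)) 0) (a i) :=
    fun i => (hasSum_extend_zero List.cons_injective).2 (h i)
  have h2 := (hasSum_ite_eq ([] : List (Fin d)) (F [])).add
    (hasSum_sum (s := Finset.univ) fun i _ => h1 i)
  convert! h2 using 1
  funext w
  cases w with
  | nil => simp
  | cons j w =>
    rw [if_neg (by simp), zero_add, Finset.sum_eq_single j, List.cons_injective.extend_apply]
    · intro i _ hi
      exact Function.extend_apply' _ _ _ (by simp [hi])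
    · simp

/-- The full Fock space `⨁_w G`, summed over all words `w`, with the components of a vector at the
empty word and, for each letter `i`, along the words beginning with `i`. These components define a
unitary operator from the Fock space onto `G ⊕ (Fock space)^d`. -/
theorem exists_fock (d : ℕ) (G : Type u) [NormedAddCommGroup G] [InnerProductSpace ℂ G]
    [CompleteSpace G] :
    ∃ (F : Type u) (_ : NormedAddCommGroup F) (_ : InnerProductSpace ℂ F) (_ : CompleteSpace F)
      (q : F →L[ℂ] G) (r : Fin d → F →L[ℂ] F),
      (∀ x y, inner ℂ x y = inner ℂ (q x) (q y) + ∑ i, inner ℂ (r i x) (r i y)) ∧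
      ∀ (g : G) (f : Fin d → F), ∃ x, q x = g ∧ ∀ i, r i x = f i := by
  have hmem : ∀ (i : Fin d) (x : lp (fun _ : List (Fin d) => G) 2),
      Memℓp (fun w => x (i :: w)) 2 := fun i x => by
    have := (lp.memℓp x).summable (by simp)
    refine memℓp_gen ?_
    exact this.comp_injective List.cons_injective
  let r : Fin d → lp (fun _ : List (Fin d) => G) 2 →ₗ[ℂ] lp (fun _ : List (Fin d) => G) 2 :=
    fun i =>
    { toFun := fun x => ⟨fun w => x (i :: w), hmem i x⟩
      map_add' := fun x y => rfl
      map_smul' := fun c x => rfl }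
  let q : lp (fun _ : List (Fin d) => G) 2 →ₗ[ℂ] G :=
    { toFun := fun x => x []
      map_add' := fun x y => rfl
      map_smul' := fun c x => rfl }
  have hinner : ∀ x y, inner ℂ x y = inner ℂ (q x) (q y) + ∑ i, inner ℂ (r i x) (r i y) :=
    fun x y => (lp.hasSum_inner x y).unique
      (hasSum_list fun i => lp.hasSum_inner (r i x) (r i y))
  have hnorm : ∀ x, ‖x‖ ^ 2 = ‖q x‖ ^ 2 + ∑ i, ‖r i x‖ ^ 2 := fun x => by
    have := hinner x x
    simp only [inner_self_eq_norm_sq_to_K] at this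
    exact_mod_cast this
  refine ⟨lp (fun _ : List (Fin d) => G) 2, inferInstance, inferInstance, inferInstance,
    q.mkContinuous 1 fun x => ?_, fun i => (r i).mkContinuous 1 fun x => ?_, hinner, ?_⟩
  · rw [one_mul]
    refine (pow_le_pow_iff_left₀ (norm_nonneg _) (norm_nonneg _) two_ne_zero).1 ?_
    rw [hnorm x]
    exact le_add_of_nonneg_right (Finset.sum_nonneg fun i _ => by positivity)
  · rw [one_mul]
    refine (pow_le_pow_iff_left₀ (norm_nonneg _) (norm_nonneg _) two_ne_zero).1 ?_
    have := Finset.single_le_sum (f := fun i => ‖r i x‖ ^ 2) (fun _ _ => by positivity)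
      (Finset.mem_univ i)
    nlinarith [hnorm x, sq_nonneg ‖q x‖]
  · intro g f
    have hm : Memℓp (fun w : List (Fin d) => List.casesOn (motive := fun _ => G) w g
        (fun i w => f i w)) 2 := by
      refine memℓp_gen ?_
      exact (hasSum_list fun i => ((lp.memℓp (f i)).summable (by simp)).hasSum).summable
    exact ⟨⟨_, hm⟩, rfl, fun i => rfl⟩

end Fock

/-! ### Cuntz dilations of row contractions -/

section Dilate

variable {d : ℕ} {E : Type u} [NormedAddCommGroup E] [InnerProductSpace ℂ E] [CompleteSpace E]

/-- A column contraction `C` is the corner of an isometric column `C'` on a larger space `E ⊕ F`.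
If `D` is a defect operator, `D^* D = 1 - ∑ C_i^* C_i`, then
`C'_i (x, f) = (C_i x, δ_{i i₀} s(D x, f))` with an isometry `s : E ⊕ F → F`. -/
theorem exists_isometric_column (hd : 0 < d) (C : Fin d → E →L[ℂ] E)
    (hC : ∀ x, ∑ i, ‖C i x‖ ^ 2 ≤ ‖x‖ ^ 2) :
    ∃ (E' : Type u) (_ : NormedAddCommGroup E') (_ : InnerProductSpace ℂ E') (_ : CompleteSpace E')
      (J : E →ₗᵢ[ℂ] E') (C' : Fin d → E' →L[ℂ] E'),
      (∀ x y, inner ℂ x y = ∑ i, inner ℂ (C' i x) (C' i y)) ∧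
      ∀ i, adjoint J.toContinuousLinearMap ∘L C' i = C i ∘L adjoint J.toContinuousLinearMap := by
  obtain ⟨D, hD⟩ : ∃ D : E →L[ℂ] E, 1 - ∑ i, star (C i) * C i = star D * D := by
    refine CStarAlgebra.nonneg_iff_eq_star_mul_self.1 ?_
    rw [nonneg_iff_isPositive, isPositive_iff_complex]
    intro x
    have : inner ℂ ((1 - ∑ i, star (C i) * C i : E →L[ℂ] E) x) x =
        ((‖x‖ ^ 2 - ∑ i, ‖C i x‖ ^ 2 : ℝ) : ℂ) := by
      simp [sum_apply, star_eq_adjoint, adjoint_inner_left,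
        inner_self_eq_norm_sq_to_K]
    rw [this]
    simp only [RCLike.re_to_complex, Complex.ofReal_re]
    exact ⟨trivial, sub_nonneg.2 (hC x)⟩
  have hD' : ∀ x y, inner ℂ x y = ∑ i, inner ℂ (C i x) (C i y) + inner ℂ (D x) (D y) := by
    intro x y
    have := congrArg (fun T : E →L[ℂ] E => inner ℂ x (T y)) hD
    simp only [sub_apply, one_apply_eq_self, sum_apply, mul_apply_eq_comp, inner_sub_right,
      inner_sum, star_eq_adjoint, adjoint_inner_right] at this
    rw [← this]; ring
  obtain ⟨F, _, _, _, q, r, hinner, hsurj⟩ := exists_fock d E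
  let i₀ : Fin d := ⟨0, hd⟩
  let s : E × F →L[ℂ] F := (adjoint q).coprod (adjoint (r i₀))
  -- `s` is the isometry placing `g` at the empty word and `f` along the words beginning with `i₀`
  have hs : ∀ g f, q (s (g, f)) = g ∧ ∀ i, r i (s (g, f)) = Pi.single (M := fun _ => F) i₀ f i := by
    intro g f
    obtain ⟨z, hz1, hz2⟩ := hsurj g (Pi.single i₀ f)
    have : s (g, f) = z := by
      refine ext_inner_right ℂ fun y => ?_
      rw [hinner z y, hz1, Finset.sum_eq_single i₀]
      · simp [s, inner_add_left, adjoint_inner_left, hz2]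
      · intro k _ hk
        simp [hz2, hk]
      · simp
    rw [this]
    exact ⟨hz1, hz2⟩
  have hs' : ∀ a b, inner ℂ (s a) (s b) = inner ℂ a.1 b.1 + inner ℂ a.2 b.2 := by
    rintro ⟨a, a'⟩ ⟨b, b'⟩
    rw [hinner, (hs a a').1, (hs b b').1, Finset.sum_eq_single i₀]
    · simp [hs]
    · intro k _ hk
      simp [hs, hk]
    · simp
  let e := WithLp.prodContinuousLinearEquiv 2 ℂ E F
  let p₁ : WithLp 2 (E × F) →L[ℂ] E := fst ℂ E F ∘L e
  let p₂ : WithLp 2 (E × F) →L[ℂ] F := snd ℂ E F ∘L e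
  let C' : Fin d → WithLp 2 (E × F) →L[ℂ] WithLp 2 (E × F) := fun i =>
    e.symm ∘L (C i ∘L p₁).prod (if i = i₀ then s ∘L (D ∘L p₁).prod p₂ else 0)
  let J : E →ₗᵢ[ℂ] WithLp 2 (E × F) :=
    { toLinearMap := e.symm.toLinearMap ∘ₗ LinearMap.inl ℂ E F
      norm_map' := fun x => by simp [e] }
  have hJ : ∀ x, adjoint J.toContinuousLinearMap x = x.fst := fun x => by
    refine ext_inner_left ℂ fun y => ?_
    simp [adjoint_inner_right, J, e, WithLp.prod_inner_apply]
  refine ⟨WithLp 2 (E × F), inferInstance, inferInstance, inferInstance, J, C', ?_, ?_⟩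
  · intro x y
    have h1 : ∀ i, inner ℂ (C' i x) (C' i y) = inner ℂ (C i x.fst) (C i y.fst) +
        if i = i₀ then inner ℂ (D x.fst) (D y.fst) + inner ℂ x.snd y.snd else 0 := by
      intro i
      by_cases h : i = i₀
      · simp [C', e, h, WithLp.prod_inner_apply, hs', p₁, p₂]
      · simp [C', e, h, WithLp.prod_inner_apply, p₁, p₂]
    simp_rw [h1, Finset.sum_add_distrib]
    simp [WithLp.prod_inner_apply, hD' x.fst y.fst, add_assoc]
  · intro i
    ext x
    simp [hJ, C', e, p₁]

/-- An isometric column `C` is the restriction of a unitary column `B` to an invariant subspace.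
If `F` is the Fock space of the complement `Rᗮ` of the range of `C` in `E^d`, then
`E ⊕ F ≅ E ⊕ Rᗮ ⊕ F^d ≅ E^d ⊕ F^d`. -/
theorem exists_unitary_column (C : Fin d → E →L[ℂ] E)
    (hC : ∀ x y, inner ℂ x y = ∑ i, inner ℂ (C i x) (C i y)) :
    ∃ (E' : Type u) (_ : NormedAddCommGroup E') (_ : InnerProductSpace ℂ E') (_ : CompleteSpace E')
      (J : E →ₗᵢ[ℂ] E') (B : Fin d → E' →L[ℂ] E'),
      (∀ x y, inner ℂ x y = ∑ i, inner ℂ (B i x) (B i y)) ∧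
      (∀ f : Fin d → E', ∃ x, ∀ i, B i x = f i) ∧ ∀ i x, B i (J x) = J (C i x) := by
  let c : E →ₗᵢ[ℂ] PiLp 2 (fun _ : Fin d => E) := LinearMap.isometryOfInner
    ((WithLp.linearEquiv 2 ℂ (Fin d → E)).symm.toLinearMap ∘ₗ
      LinearMap.pi fun i => (C i).toLinearMap)
    fun x y => by simp [PiLp.inner_apply, hC x y]
  have hc : ∀ x i, c x i = C i x := fun x i => rfl
  let R : Submodule ℂ (PiLp 2 (fun _ : Fin d => E)) := LinearMap.range c.toLinearMap
  have hR : IsClosed (R : Set (PiLp 2 (fun _ : Fin d => E))) := by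
    have h : (R : Set (PiLp 2 (fun _ : Fin d => E))) = Set.range c := rfl
    rw [h]
    exact c.isometry.isClosedEmbedding.isClosed_range
  have : CompleteSpace R := hR.completeSpace_coe
  obtain ⟨F, _, _, _, q, r, hinner, hsurj⟩ := exists_fock d Rᗮ
  let e := WithLp.prodContinuousLinearEquiv 2 ℂ E F
  let p₁ : WithLp 2 (E × F) →L[ℂ] E := fst ℂ E F ∘L e
  let p₂ : WithLp 2 (E × F) →L[ℂ] F := snd ℂ E F ∘L e
  let π : Fin d → Rᗮ →L[ℂ] E := fun i => PiLp.proj 2 (fun _ : Fin d => E) i ∘L Rᗮ.subtypeL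
  let B : Fin d → WithLp 2 (E × F) →L[ℂ] WithLp 2 (E × F) := fun i =>
    e.symm ∘L (C i ∘L p₁ + π i ∘L q ∘L p₂).prod (r i ∘L p₂)
  have hB : ∀ i x, B i x = WithLp.toLp 2 ((c x.fst + (q x.snd : PiLp 2 (fun _ : Fin d => E))) i,
      r i x.snd) := fun i x => rfl
  let J : E →ₗᵢ[ℂ] WithLp 2 (E × F) :=
    { toLinearMap := e.symm.toLinearMap ∘ₗ LinearMap.inl ℂ E F
      norm_map' := fun x => by simp [e] }
  have hJ : ∀ x, J x = WithLp.toLp 2 (x, 0) := fun x => rfl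
  refine ⟨WithLp 2 (E × F), inferInstance, inferInstance, inferInstance, J, B, ?_, ?_, ?_⟩
  · intro x y
    have h0 : ∀ (a : E) (l : Rᗮ), inner ℂ (c a) (l : PiLp 2 (fun _ : Fin d => E)) = 0 :=
      fun a l => l.2 _ ⟨a, rfl⟩
    have h0' : ∀ (a : E) (l : Rᗮ), inner ℂ (l : PiLp 2 (fun _ : Fin d => E)) (c a) = 0 :=
      fun a l => inner_eq_zero_symm.1 (h0 a l)
    change inner ℂ x.fst y.fst + inner ℂ x.snd y.snd = _
    simp only [hB, WithLp.prod_inner_apply, Finset.sum_add_distrib]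
    rw [← PiLp.inner_apply, inner_add_left, inner_add_right, inner_add_right, h0, h0',
      c.inner_map_map, hinner x.snd y.snd, Submodule.coe_inner]
    simp [add_assoc]
  · intro f
    obtain ⟨_, ⟨a, rfl⟩, l, hl, hal⟩ := R.exists_add_mem_mem_orthogonal
      (WithLp.toLp 2 fun i => (f i).fst)
    obtain ⟨g, hg, hg'⟩ := hsurj ⟨l, hl⟩ fun i => (f i).snd
    refine ⟨WithLp.toLp 2 (a, g), fun i => ?_⟩
    have := congrArg (fun v : PiLp 2 (fun _ : Fin d => E) => v i) hal
    change WithLp.toLp 2 ((c a + (q g : PiLp 2 (fun _ : Fin d => E))) i, r i g) = f i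
    have h2 : (c a + l) i = (f i).fst := this.symm
    rw [hg, hg', h2]
    rfl
  · intro i x
    simp [hB, hJ, hc]

/-- The Cuntz dilation of a row contraction: if `∑ T_i T_i^* ≤ 1`, then there is a Cuntz family `S`
on a space containing `E` whose word powers compress to those of `T`. -/
theorem exists_cuntz_dilation (hd : 0 < d) (T : Fin d → E →L[ℂ] E)
    (hT : ∀ x, ∑ i, ‖adjoint (T i) x‖ ^ 2 ≤ ‖x‖ ^ 2) :
    ∃ (𝒦 : Type u) (_ : NormedAddCommGroup 𝒦) (_ : InnerProductSpace ℂ 𝒦) (_ : CompleteSpace 𝒦)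
      (S : Fin d → 𝒦 →L[ℂ] 𝒦) (J : E →ₗᵢ[ℂ] 𝒦), IsCuntzFamily S ∧
      ∀ α, adjoint J.toContinuousLinearMap ∘L wordPow S α ∘L J.toContinuousLinearMap =
        wordPow T α := by
  obtain ⟨E₁, _, _, _, J₁, C₁, hC₁, hJ₁⟩ := exists_isometric_column hd (fun i => adjoint (T i)) hT
  obtain ⟨E₂, _, _, _, J₂, B, hB, hsurj, hJ₂⟩ := exists_unitary_column C₁ hC₁
  refine ⟨E₂, inferInstance, inferInstance, inferInstance, fun i => adjoint (B i), J₂.comp J₁,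
    .of_column hB hsurj, fun α => ?_⟩
  -- `E₁` is coinvariant for the Cuntz family, and `E` is invariant in `E₁`
  have h₂ : ∀ i x, adjoint J₂.toContinuousLinearMap (adjoint (B i) x) =
      adjoint (C₁ i) (adjoint J₂.toContinuousLinearMap x) := fun i x => by
    refine ext_inner_right ℂ fun y => ?_
    simp [adjoint_inner_left, hJ₂]
  have h₁ : ∀ i x, adjoint (C₁ i) (J₁ x) = J₁ (T i x) := fun i x => by
    have := congrArg adjoint (hJ₁ i)
    rw [adjoint_comp, adjoint_comp, adjoint_adjoint, adjoint_adjoint] at this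
    exact congrArg (fun S : E →L[ℂ] E₁ => S x) this
  have h₂' : ∀ α x, adjoint J₂.toContinuousLinearMap (wordPow (fun i => adjoint (B i)) α (J₂ x)) =
      wordPow (fun i => adjoint (C₁ i)) α x := by
    intro α
    induction α using FreeMonoid.inductionOn' with
    | one =>
      intro x
      refine ext_inner_right ℂ fun y => ?_
      simp [wordPow_one, adjoint_inner_left]
    | of_mul i α ih =>
      intro x
      simp [wordPow_of_mul, h₂, ih]
  have h₁' : ∀ α x, wordPow (fun i => adjoint (C₁ i)) α (J₁ x) = J₁ (wordPow T α x) := by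
    intro α
    induction α using FreeMonoid.inductionOn' with
    | one => simp [wordPow_one]
    | of_mul i α ih => simp [wordPow_of_mul, h₁, ih]
  ext x
  refine ext_inner_right ℂ fun y => ?_
  have : inner ℂ (J₁ (wordPow T α x)) (J₁ y) = inner ℂ (wordPow T α x) y := J₁.inner_map_map _ _
  rw [← this, ← h₁', ← h₂']
  simp [adjoint_inner_left]

end Dilate

/-! ### Positive definite kernels -/

section Kolmogorov

variable {X : Type*} {H : Type*} [NormedAddCommGroup H] [InnerProductSpace ℂ H]

theorem IsPosDefKernel.finset_sum {K : X → X → H →L[ℂ] H} (hK : IsPosDefKernel K)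
    {ι : Type*} (s : Finset ι) (x : ι → X) (u : ι → H) :
    0 ≤ ∑ i ∈ s, ∑ j ∈ s, inner ℂ (u i) (K (x i) (x j) (u j)) := by
  have := hK s.card (fun i => x (s.equivFin.symm i)) (fun i => u (s.equivFin.symm i))
  rw [← Finset.sum_coe_sort s]
  simp_rw [← Finset.sum_coe_sort s]
  rw [← s.equivFin.symm.sum_comp]
  simp_rw [← s.equivFin.symm.sum_comp (fun j : s => inner ℂ (u _) (K (x _) (x j) (u j)))]
  exact this

/-- A positive definite kernel over `ℂ` is automatically Hermitian, by polarization. -/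
theorem IsPosDefKernel.inner_symm {K : X → X → H →L[ℂ] H} (hK : IsPosDefKernel K) (x y : X)
    (u v : H) : starRingEnd ℂ (inner ℂ u (K x y v)) = inner ℂ v (K y x u) := by
  have h1 := fun (x : X) (u : H) => (Complex.nonneg_iff.1 (hK 1 ![x] ![u])).2
  have h2 := fun v : H => (Complex.nonneg_iff.1 (hK 2 ![x, y] ![u, v])).2
  have ha := h2 v
  have hb := h2 (Complex.I • v)
  have hx := h1 x u
  have hy := h1 y v
  simp [Fin.sum_univ_two] at ha hb hx hy
  apply Complex.ext <;> simp only [Complex.conj_re, Complex.conj_im] <;> linarith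

variable [CompleteSpace H]

theorem IsPosDefKernel.posSemidef {K : X → X → H →L[ℂ] H} (hK : IsPosDefKernel K) :
    (Matrix.of K).PosSemidef := by
  have hH : (Matrix.of K).IsHermitian := by
    ext x y u
    refine ext_inner_left ℂ fun v => ?_
    simp only [Matrix.conjTranspose_apply, Matrix.of_apply, star_eq_adjoint, adjoint_inner_right]
    rw [← hK.inner_symm, inner_conj_symm]
  refine ((RKHS.posSemidef_tfae (𝕜 := ℂ) (K := Matrix.of K)).out 0 2).2 ?_
  refine ⟨hH, fun w => ?_⟩
  have := (Complex.nonneg_iff.1 (hK.finset_sum w.support id w)).1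
  simp only [Finsupp.sum, Matrix.of_apply, RCLike.re_to_complex]
  rw [← Complex.conj_re, map_sum]
  simp_rw [map_sum, inner_conj_symm]
  rw [Finset.sum_comm]
  exact this

/-- The Kolmogorov decomposition `K(x, y) = V_x^* V_y` of a positive definite kernel. -/
theorem IsPosDefKernel.exists_kolmogorov {X : Type} {H : Type u} [NormedAddCommGroup H]
    [InnerProductSpace ℂ H] [CompleteSpace H] {K : X → X → H →L[ℂ] H} (hK : IsPosDefKernel K) :
    ∃ (E : Type u) (_ : NormedAddCommGroup E) (_ : InnerProductSpace ℂ E) (_ : CompleteSpace E)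
      (V : X → H →L[ℂ] E), (∀ x y, K x y = adjoint (V x) ∘L V y) ∧
      (Submodule.span ℂ {e : E | ∃ x u, V x u = e}).topologicalClosure = ⊤ := by
  have : Fact (Matrix.of K).PosSemidef := ⟨hK.posSemidef⟩
  refine ⟨RKHS.OfKernel (Matrix.of K), inferInstance, inferInstance, inferInstance,
    RKHS.kerFun (RKHS.OfKernel (Matrix.of K)), fun x y => ?_, RKHS.kerFun_dense _⟩
  rw [← RKHS.kernel_apply, RKHS.OfKernel.kernel_ofKernel, Matrix.of_apply]

end Kolmogorov

/-! ### The shift on the Kolmogorov space -/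

section Shift

variable {d : ℕ} {H : Type u} [NormedAddCommGroup H] [InnerProductSpace ℂ H] [CompleteSpace H]
  {K : FreeMonoid (Fin d) → FreeMonoid (Fin d) → H →L[ℂ] H}

/-- The inequality `K_Σ ≤ K` says that the right shifts `V_α u ↦ V_{αi} u` on the Kolmogorov space
of `K` are well defined and form a column contraction. -/
theorem KernelLE.exists_column (h : KernelLE (shiftKernel K) K)
    {E : Type*} [NormedAddCommGroup E] [InnerProductSpace ℂ E] [CompleteSpace E]
    {V : FreeMonoid (Fin d) → H →L[ℂ] E} (hV : ∀ x y, K x y = adjoint (V x) ∘L V y)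
    (hdense : (Submodule.span ℂ {e : E | ∃ x u, V x u = e}).topologicalClosure = ⊤) :
    ∃ C : Fin d → E →L[ℂ] E, (∀ i α u, C i (V α u) = V (α * FreeMonoid.of i) u) ∧
      ∀ x, ∑ i, ‖C i x‖ ^ 2 ≤ ‖x‖ ^ 2 := by
  let e : (FreeMonoid (Fin d) →₀ H) →ₗ[ℂ] E := Finsupp.lsum ℂ fun α => (V α).toLinearMap
  let f : Fin d → (FreeMonoid (Fin d) →₀ H) →ₗ[ℂ] E := fun i =>
    Finsupp.lsum ℂ fun α => (V (α * FreeMonoid.of i)).toLinearMap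
  have he : ∀ w, e w = ∑ α ∈ w.support, V α (w α) := fun w => by simp [e, Finsupp.sum]
  have hf : ∀ i w, f i w = ∑ α ∈ w.support, V (α * FreeMonoid.of i) (w α) :=
    fun i w => by simp [f, Finsupp.sum]
  have hnorm : ∀ w, ∑ i, ‖f i w‖ ^ 2 ≤ ‖e w‖ ^ 2 := fun w => by
    have h1 := IsPosDefKernel.finset_sum h w.support id w
    have h2 : ∑ α ∈ w.support, ∑ β ∈ w.support,
        inner ℂ (w α) ((K (id α) (id β) - shiftKernel K (id α) (id β)) (w β)) =
        inner ℂ (e w) (e w) - ∑ i, inner ℂ (f i w) (f i w) := by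
      simp only [he, hf, sum_inner, inner_sum, shiftKernel, hV, sub_apply, sum_apply, id,
        coe_comp, Function.comp_apply, inner_sub_right, adjoint_inner_right,
        Finset.sum_sub_distrib]
      congr 1
      · exact Finset.sum_comm
      · rw [Finset.sum_congr rfl fun _ _ => Finset.sum_comm, Finset.sum_comm]
        exact Finset.sum_congr rfl fun _ _ => Finset.sum_comm
    rw [h2] at h1
    simp only [inner_self_eq_norm_sq_to_K] at h1
    have := sub_nonneg.1 h1
    exact_mod_cast this
  have hdr : DenseRange e := by
    rw [DenseRange, ← LinearMap.coe_range, Submodule.dense_iff_topologicalClosure_eq_top]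
    refine top_le_iff.1 (hdense ▸ Submodule.topologicalClosure_mono (Submodule.span_le.2 ?_))
    rintro _ ⟨α, u, rfl⟩
    exact ⟨Finsupp.single α u, by simp [e]⟩
  have hle : ∀ i, ∃ c : ℝ, ∀ w, ‖f i w‖ ≤ c * ‖e w‖ := fun i => ⟨1, fun w => by
    rw [one_mul]
    refine (pow_le_pow_iff_left₀ (norm_nonneg _) (norm_nonneg _) two_ne_zero).1 ?_
    exact (Finset.single_le_sum (f := fun i => ‖f i w‖ ^ 2) (fun _ _ => by positivity)
      (Finset.mem_univ i)).trans (hnorm w)⟩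
  have hC : ∀ i w, (f i).extendOfNorm e (e w) = f i w := fun i w =>
    LinearMap.extendOfNorm_eq hdr (hle i) w
  refine ⟨fun i => (f i).extendOfNorm e, fun i α u => ?_, fun x => ?_⟩
  · simpa [e, f] using hC i (Finsupp.single α u)
  · induction x using hdr.induction_on with
    | hp => exact isClosed_le (by fun_prop) (by fun_prop)
    | ih w => simpa only [hC] using hnorm w

/-- A positive definite kernel with `K(∅, ∅) = 1` and `K_Σ ≤ K` is the compression of a Cuntz
family: the Cuntz dilation of the shifts on the Kolmogorov space, together with the projection
onto that space. -/
theorem KernelLE.exists_realization (hd : 0 < d) (hK : IsPosDefKernel K) (h1 : K 1 1 = 1)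
    (h : KernelLE (shiftKernel K) K) :
    ∃ (𝒦 : Type u) (_ : NormedAddCommGroup 𝒦) (_ : InnerProductSpace ℂ 𝒦)
      (_ : CompleteSpace 𝒦) (S : Fin d → 𝒦 →L[ℂ] 𝒦) (P : 𝒦 →L[ℂ] 𝒦) (W : H →ₗᵢ[ℂ] 𝒦),
      IsCuntzFamily S ∧ IsStarProjection P ∧ ∀ α β, K α β =
        adjoint W.toContinuousLinearMap ∘L wordPow S α ∘L P ∘L adjoint (wordPow S β) ∘L
          W.toContinuousLinearMap := by
  obtain ⟨E, _, _, _, V, hV, hdense⟩ := hK.exists_kolmogorov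
  obtain ⟨C, hCV, hC⟩ := h.exists_column hV hdense
  obtain ⟨𝒦, _, _, _, S, J, hS, hJ⟩ := exists_cuntz_dilation hd (fun i => adjoint (C i))
    (by simpa using hC)
  have hV1 : ∀ u, ‖V 1 u‖ = ‖u‖ := fun u => by
    have : inner ℂ (V 1 u) (V 1 u) = inner ℂ u u := by
      rw [← adjoint_inner_right, ← comp_apply, ← hV, h1, one_apply_eq_self]
    rw [@norm_eq_sqrt_re_inner ℂ, this, ← @norm_eq_sqrt_re_inner ℂ]
  have hVα : ∀ α u, adjoint (wordPow (fun i => adjoint (C i)) α) (V 1 u) = V α u := by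
    -- the adjoint reverses the order of the letters, so `V_α` arises by appending letters on the
    -- right
    have key : ∀ α β u, adjoint (wordPow (fun i => adjoint (C i)) α) (V β u) = V (β * α) u := by
      intro α
      induction α using FreeMonoid.inductionOn' with
      | one => simp [wordPow_one, ← star_eq_adjoint]
      | of_mul i α ih =>
        intro β u
        rw [wordPow_of_mul, ← star_eq_adjoint, star_mul, star_eq_adjoint, star_eq_adjoint,
          adjoint_adjoint, mul_apply_eq_comp, hCV, ih, mul_assoc]
    intro α u
    rw [key, one_mul]
  let W : H →ₗᵢ[ℂ] 𝒦 := J.comp ⟨(V 1).toLinearMap, hV1⟩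
  have hW : W.toContinuousLinearMap = J.toContinuousLinearMap ∘L V 1 := rfl
  have hJJ : adjoint J.toContinuousLinearMap ∘L J.toContinuousLinearMap = 1 := by
    simpa only [wordPow_one] using! hJ 1
  refine ⟨𝒦, inferInstance, inferInstance, inferInstance, S,
    J.toContinuousLinearMap ∘L adjoint J.toContinuousLinearMap, W, hS, ⟨?_, ?_⟩, fun α β => ?_⟩
  · ext x
    exact congrArg (fun y => J y)
      (congrArg (fun T : E →L[ℂ] E => T (adjoint J.toContinuousLinearMap x)) hJJ)
  · rw [IsSelfAdjoint, star_eq_adjoint, adjoint_comp, adjoint_adjoint]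
  · have hJ' := congrArg adjoint (hJ β)
    simp only [adjoint_comp, adjoint_adjoint] at hJ'
    ext u
    refine ext_inner_left ℂ fun v => ?_
    have e1 : inner ℂ v (K α β u) = inner ℂ (V α v) (V β u) := by
      rw [hV, comp_apply, adjoint_inner_right]
    rw [e1, ← hVα α, ← hVα β, adjoint_inner_left, ← hJ α, ← hJ', hW]
    simp [adjoint_inner_right]

end Shift

/-! ### The quadratic form on the cyclic subspace -/

section Cyclic

variable {d : ℕ} {H : Type*} [NormedAddCommGroup H] [InnerProductSpace ℂ H] [CompleteSpace H]
  {K : FreeMonoid (Fin d) → FreeMonoid (Fin d) → H →L[ℂ] H}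
  {𝒦 : Type*} [NormedAddCommGroup 𝒦] [InnerProductSpace ℂ 𝒦] [CompleteSpace 𝒦]
  {S : Fin d → 𝒦 →L[ℂ] 𝒦} {P : 𝒦 →L[ℂ] 𝒦} {W : H →ₗᵢ[ℂ] 𝒦}

theorem wordPow_mul_of {d : ℕ} {E : Type*} [NormedAddCommGroup E] [InnerProductSpace ℂ E]
    (S : Fin d → E →L[ℂ] E) (α : FreeMonoid (Fin d)) (i : Fin d) :
    wordPow S (α * FreeMonoid.of i) = wordPow S α * S i := by
  simp [wordPow]

theorem inner_kernel_eq (hK : ∀ α β, K α β =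
      adjoint W.toContinuousLinearMap ∘L wordPow S α ∘L P ∘L adjoint (wordPow S β) ∘L
        W.toContinuousLinearMap) (α β : FreeMonoid (Fin d)) (u v : H) :
    inner ℂ u (K α β v) =
      inner ℂ (adjoint (wordPow S α) (W u)) (P (adjoint (wordPow S β) (W v))) := by
  simp [hK, adjoint_inner_right, adjoint_inner_left]

theorem inner_shiftKernel_eq (hK : ∀ α β, K α β =
      adjoint W.toContinuousLinearMap ∘L wordPow S α ∘L P ∘L adjoint (wordPow S β) ∘L
        W.toContinuousLinearMap) (α β : FreeMonoid (Fin d)) (u v : H) :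
    inner ℂ u (shiftKernel K α β v) = inner ℂ (adjoint (wordPow S α) (W u))
      ((∑ i, S i * P * adjoint (S i)) (adjoint (wordPow S β) (W v))) := by
  simp only [shiftKernel, sum_apply, inner_sum, inner_kernel_eq hK, wordPow_mul_of,
    ← star_eq_adjoint, star_mul, mul_apply_eq_comp]
  simp only [star_eq_adjoint, adjoint_inner_left]

theorem leOn_iff_kernelLE (hK : ∀ α β, K α β =
      adjoint W.toContinuousLinearMap ∘L wordPow S α ∘L P ∘L adjoint (wordPow S β) ∘L
        W.toContinuousLinearMap) :
    LEOn (∑ i, S i * P * adjoint (S i)) P (cyclicSubspace S W) ↔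
      KernelLE (shiftKernel K) K := by
  set Q := ∑ i, S i * P * adjoint (S i) with hQ
  have key : ∀ (N : ℕ) (α : Fin N → FreeMonoid (Fin d)) (u : Fin N → H),
      ∑ i, ∑ j, inner ℂ (u i) ((K (α i) (α j) - shiftKernel K (α i) (α j)) (u j)) =
      inner ℂ (∑ i, adjoint (wordPow S (α i)) (W (u i)))
        (P (∑ i, adjoint (wordPow S (α i)) (W (u i)))) -
      inner ℂ (∑ i, adjoint (wordPow S (α i)) (W (u i)))
        (Q (∑ i, adjoint (wordPow S (α i)) (W (u i)))) := by
    intro N α u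
    simp only [sub_apply, inner_sub_right, inner_kernel_eq hK, inner_shiftKernel_eq hK, map_sum,
      sum_inner, inner_sum, Finset.sum_sub_distrib, ← hQ]
    congr 1 <;> exact Finset.sum_comm
  constructor
  · intro h N α u
    rw [key, sub_nonneg]
    refine h _ (Submodule.le_topologicalClosure _ (Submodule.sum_mem _ fun i _ => ?_))
    exact Submodule.subset_span ⟨_, _, rfl⟩
  · intro h y hy
    have hcl : IsClosed {y : 𝒦 | inner ℂ y (Q y) ≤ inner ℂ y (P y)} :=
      isClosed_le (by fun_prop) (by fun_prop)
    refine closure_minimal ?_ hcl hy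
    intro y hy
    obtain ⟨N, c, g, rfl⟩ := Submodule.mem_span_set'.1 hy
    choose α u hu using fun i => (g i).2
    have e : ∑ i, c i • (g i : 𝒦) = ∑ i, adjoint (wordPow S (α i)) (W (c i • u i)) :=
      Finset.sum_congr rfl fun i _ => by rw [hu, map_smul, map_smul]
    have := h N α fun i => c i • u i
    rw [key, sub_nonneg] at this
    simpa only [Set.mem_ofPred_eq, e] using this

end Cyclic

/-! ### The moment kernel -/

section Moment

variable {d : ℕ} {Ω H : Type*} [MeasurableSpace Ω] [NormedAddCommGroup H]
  [InnerProductSpace ℂ H] [CompleteSpace H] {ℙ : Measure Ω} {A : Fin d → Ω → H →L[ℂ] H}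

theorem inner_momentKernel (hA : IsRandomTuple ℙ A) (α β : FreeMonoid (Fin d)) (u v : H) :
    inner ℂ u (momentKernel hA α β v) =
      ∫ ω, inner ℂ u (wordPow (fun i => A i ω) α (adjoint (wordPow (fun i => A i ω) β) v)) ∂ℙ :=
  (integral_inner (hA.integrable_moment α β v) u).symm

theorem momentKernel_one_one [IsProbabilityMeasure ℙ] (hA : IsRandomTuple ℙ A) :
    momentKernel hA 1 1 = 1 := by
  ext v
  simp [momentKernel_apply, wordPow_one, ← star_eq_adjoint]

/-- The quadratic form of the moment kernel at `(α_j, u_j)` is `𝔼 ‖∑_j (A^{α_j})^* u_j‖²`. -/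
theorem isPosDefKernel_momentKernel (hA : IsRandomTuple ℙ A) :
    IsPosDefKernel (momentKernel hA) := by
  intro N α u
  have hint : ∀ i j, Integrable (fun ω => inner ℂ (u i)
      (wordPow (fun i => A i ω) (α i) (adjoint (wordPow (fun i => A i ω) (α j)) (u j)))) ℙ :=
    fun i j => (hA.integrable_moment (α i) (α j) (u j)).const_inner (u i)
  have : ∑ i, ∑ j, inner ℂ (u i) (momentKernel hA (α i) (α j) (u j)) =
      ((∫ ω, ‖∑ j, adjoint (wordPow (fun i => A i ω) (α j)) (u j)‖ ^ 2 ∂ℙ : ℝ) : ℂ) := by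
    rw [← integral_complex_ofReal]
    simp_rw [inner_momentKernel]
    simp_rw [← integral_finsetSum _ fun j _ => hint _ j]
    rw [← integral_finsetSum _ fun i _ => integrable_finsetSum _ fun j _ => hint i j]
    refine integral_congr_ae (Filter.Eventually.of_forall fun ω => ?_)
    simp only [Complex.ofReal_pow]
    rw [← Complex.coe_algebraMap, ← inner_self_eq_norm_sq_to_K (𝕜 := ℂ)]
    simp only [sum_inner, inner_sum, adjoint_inner_left]
    exact Finset.sum_comm
  rw [this]
  exact Complex.zero_le_real.2 (integral_nonneg fun ω => by positivity)

end Moment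

/-! ### Dilations without a projection -/

section Free

variable {d : ℕ} {H : Type*} [NormedAddCommGroup H] [InnerProductSpace ℂ H] [CompleteSpace H]
  {K : FreeMonoid (Fin d) → FreeMonoid (Fin d) → H →L[ℂ] H}
  {𝒦 : Type*} [NormedAddCommGroup 𝒦] [InnerProductSpace ℂ 𝒦] [CompleteSpace 𝒦]
  {S : Fin d → 𝒦 →L[ℂ] 𝒦} {P : 𝒦 →L[ℂ] 𝒦} {W : H →ₗᵢ[ℂ] 𝒦}

theorem IsFreeRealization.shiftKernel_eq (hS : IsCuntzFamily S) (hK : IsFreeRealization K S W) :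
    shiftKernel K = K := by
  have hK' : ∀ α β, K α β = adjoint W.toContinuousLinearMap ∘L wordPow S α ∘L
      (1 : 𝒦 →L[ℂ] 𝒦) ∘L adjoint (wordPow S β) ∘L W.toContinuousLinearMap := hK
  ext α β v
  refine ext_inner_left ℂ fun u => ?_
  rw [inner_shiftKernel_eq hK', inner_kernel_eq hK']
  simp only [mul_one, hS.sum_mul_adjoint]

/-- If the forms of `P` and `∑ S_i P S_i^*` agree at the vectors `y = (S^α)^* W u` and `P y = y`,
then `∑ ‖(1 - P) S_i^* y‖² = 0`, so `P` fixes every `S_i^* y`. Starting from `K(∅, ∅) = 1`, which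
says that `P` fixes `W H`, this shows that `P` is the identity on the cyclic subspace. -/
theorem IsCuntzDilation.isFreeRealization (h : IsCuntzDilation K S P W) (h1 : K 1 1 = 1)
    (hKs : shiftKernel K = K) : IsFreeRealization K S W := by
  have hP : ∀ z, inner ℂ (z - P z) (z - P z) = inner ℂ z z - inner ℂ z (P z) := fun z => by
    have h2 : ∀ x y, inner ℂ (P x) y = inner ℂ x (P y) := fun x y => by
      rw [← adjoint_inner_right, ← star_eq_adjoint, h.projection.isSelfAdjoint.star_eq]
    have h3 : P (P z) = P z :=
      congrArg (fun T : 𝒦 →L[ℂ] 𝒦 => T z) h.projection.isIdempotentElem.eq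
    simp only [inner_sub_left, inner_sub_right, h2, h3]
    ring
  have hW : ∀ u, P (W u) = W u := fun u => by
    have := inner_kernel_eq h.kernel_eq 1 1 u u
    simp only [h1, wordPow_one, ← star_eq_adjoint, star_one, one_apply_eq_self] at this
    have h0 := hP (W u)
    rw [← this, W.inner_map_map, sub_self, inner_self_eq_zero, sub_eq_zero] at h0
    exact h0.symm
  have step : ∀ α u i, P (adjoint (wordPow S α) (W u)) = adjoint (wordPow S α) (W u) →
      P (adjoint (wordPow S (α * FreeMonoid.of i)) (W u)) =
        adjoint (wordPow S (α * FreeMonoid.of i)) (W u) := by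
    intro α u i hy
    have e1 := inner_shiftKernel_eq h.kernel_eq α α u u
    rw [hKs, inner_kernel_eq h.kernel_eq, hy] at e1
    rw [wordPow_mul_of, ← star_eq_adjoint, star_mul, star_eq_adjoint, star_eq_adjoint,
      mul_apply_eq_comp]
    generalize adjoint (wordPow S α) (W u) = y at e1
    have e2 : inner ℂ y y = ∑ i, inner ℂ (adjoint (S i) y) (adjoint (S i) y) := by
      have := congrArg (fun T : 𝒦 →L[ℂ] 𝒦 => inner ℂ y (T y)) h.cuntz.sum_mul_adjoint
      simp only [sum_apply, inner_sum, mul_apply_eq_comp, one_apply_eq_self] at this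
      simp only [adjoint_inner_left, this]
    have e3 : ∑ i, ‖adjoint (S i) y - P (adjoint (S i) y)‖ ^ 2 = 0 := by
      have : ∑ i, inner ℂ (adjoint (S i) y - P (adjoint (S i) y))
          (adjoint (S i) y - P (adjoint (S i) y)) = 0 := by
        simp only [hP, Finset.sum_sub_distrib]
        rw [← e2, e1, sub_eq_zero]
        simp [sum_apply, adjoint_inner_left]
      simp only [inner_self_eq_norm_sq_to_K] at this
      refine Complex.ofReal_eq_zero.1 (Eq.trans ?_ this)
      push_cast
      rfl
    have e4 := (Finset.sum_eq_zero_iff_of_nonneg fun _ _ => by positivity).1 e3 i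
      (Finset.mem_univ i)
    exact (sub_eq_zero.1 (norm_eq_zero.1 (pow_eq_zero_iff two_ne_zero |>.1 e4))).symm
  have key : ∀ β α u, P (adjoint (wordPow S α) (W u)) = adjoint (wordPow S α) (W u) →
      P (adjoint (wordPow S (α * β)) (W u)) = adjoint (wordPow S (α * β)) (W u) := by
    intro β
    induction β using FreeMonoid.inductionOn' with
    | one => simp
    | of_mul i β ih =>
      intro α u hα
      rw [← mul_assoc]
      exact ih _ _ (step α u i hα)
  intro α β
  rw [h.kernel_eq]
  ext u
  have := key β 1 u (by simp [wordPow_one, ← star_eq_adjoint, hW])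
  rw [one_mul] at this
  simp [this]

end Free
end FreeMoment

theorem theorem1 {d : ℕ} (hd : 1 ≤ d)
    {Ω : Type*} [MeasurableSpace Ω] (ℙ : MeasureTheory.Measure Ω)
    [MeasureTheory.IsProbabilityMeasure ℙ]
    {H : Type u} [NormedAddCommGroup H] [InnerProductSpace ℂ H] [CompleteSpace H]
    (A : Fin d → Ω → H →L[ℂ] H) (hA : FreeMoment.IsRandomTuple ℙ A) :
    -- a dilation with a projection exists if and only if `K_Σ ≤ K`
    ((∃ (𝒦 : Type u) (_ : NormedAddCommGroup 𝒦) (_ : InnerProductSpace ℂ 𝒦)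
        (_ : CompleteSpace 𝒦) (S : Fin d → 𝒦 →L[ℂ] 𝒦) (P : 𝒦 →L[ℂ] 𝒦) (W : H →ₗᵢ[ℂ] 𝒦),
        FreeMoment.IsCuntzDilation (FreeMoment.momentKernel hA) S P W) ↔
      FreeMoment.KernelLE (FreeMoment.shiftKernel (FreeMoment.momentKernel hA))
        (FreeMoment.momentKernel hA)) ∧
    -- `K_Σ = K` if and only if `K` has a realization by a Cuntz family without a projection
    (FreeMoment.shiftKernel (FreeMoment.momentKernel hA) = FreeMoment.momentKernel hA ↔
      ∃ (𝒦 : Type u) (_ : NormedAddCommGroup 𝒦) (_ : InnerProductSpace ℂ 𝒦)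
        (_ : CompleteSpace 𝒦) (S : Fin d → 𝒦 →L[ℂ] 𝒦) (W : H →ₗᵢ[ℂ] 𝒦),
        FreeMoment.IsCuntzFamily S ∧
          FreeMoment.IsFreeRealization (FreeMoment.momentKernel hA) S W) ∧
    -- in every dilation as above, `K_Σ = K` if and only if the projection can be dropped
    (∀ (𝒦 : Type v) [NormedAddCommGroup 𝒦] [InnerProductSpace ℂ 𝒦] [CompleteSpace 𝒦]
      (S : Fin d → 𝒦 →L[ℂ] 𝒦) (P : 𝒦 →L[ℂ] 𝒦) (W : H →ₗᵢ[ℂ] 𝒦),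
      FreeMoment.IsCuntzDilation (FreeMoment.momentKernel hA) S P W →
        (FreeMoment.shiftKernel (FreeMoment.momentKernel hA) = FreeMoment.momentKernel hA ↔
          FreeMoment.IsFreeRealization (FreeMoment.momentKernel hA) S W)) := by
  have h1 := FreeMoment.momentKernel_one_one hA
  have dilation (h : FreeMoment.KernelLE (FreeMoment.shiftKernel (FreeMoment.momentKernel hA))
      (FreeMoment.momentKernel hA)) :
      ∃ (𝒦 : Type u) (_ : NormedAddCommGroup 𝒦) (_ : InnerProductSpace ℂ 𝒦)
        (_ : CompleteSpace 𝒦) (S : Fin d → 𝒦 →L[ℂ] 𝒦) (P : 𝒦 →L[ℂ] 𝒦) (W : H →ₗᵢ[ℂ] 𝒦),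
        FreeMoment.IsCuntzDilation (FreeMoment.momentKernel hA) S P W := by
    obtain ⟨𝒦, _, _, _, S, P, W, hS, hP, hK⟩ :=
      h.exists_realization hd (FreeMoment.isPosDefKernel_momentKernel hA) h1
    exact ⟨𝒦, _, _, inferInstance, S, P, W, hS, hP, hK, (FreeMoment.leOn_iff_kernelLE hK).2 h⟩
  refine ⟨⟨?_, dilation⟩, ⟨fun h => ?_, ?_⟩, fun 𝒦 _ _ _ S P W hD =>
    ⟨hD.isFreeRealization h1, fun hF => hF.shiftKernel_eq hD.cuntz⟩⟩
  · rintro ⟨𝒦, _, _, _, S, P, W, hD⟩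
    exact (FreeMoment.leOn_iff_kernelLE hD.kernel_eq).1 hD.le_on
  · obtain ⟨𝒦, _, _, _, S, P, W, hD⟩ := dilation (by
      rw [h]
      intro N x u
      simp)
    exact ⟨𝒦, _, _, inferInstance, S, W, hD.cuntz, hD.isFreeRealization h1 h⟩
  · rintro ⟨𝒦, _, _, _, S, W, hS, hF⟩
    exact hF.shiftKernel_eq hS
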